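/- A cube in $\mathbb{R}^d$ is a set $C=\prod_{i=1}^d[a_i,a_i+\ell)$ with $a\in\mathbb{R}^d$ and side length $\|C\|=\ell>0$. For $A\subseteq\mathbb{R}^d$ let $\lfloor A\rfloor$ be the set of elements of $A$ rounded down in each coordinate. For $\alpha\ge 0$ the $\alpha$-counting measure and the counting dimension of $A$ are \[ \mathrm{N}^\alpha(A)=\limsup_{\|C\|\to\infty}\frac{\big|\lfloor A\rfloor\cap C\big|}{\|C\|^\alpha} =\lim_{\ell\to\infty}\ \sup_{\|C\|\ge \ell}\frac{\big|\lfloor A\rfloor\cap C\big|}{\|C\|^\alpha}\in[0,\infty], \qquad \mathrm{cdim}(A)=\inf\{\alpha\ge 0 : \mathrm{N}^\alpha(A)=0\}, \] where $C$ ranges over all cubes. Let $0\le k\le d$ be integers and let $\mathcal{U}_{d,k}$ be the space of orthogonal projections $U$ of $\mathbb{R}^d$ with $\dim(\operatorname{range}U)=k$. Equip it with the Borel probability measure that corresponds, under $U\mapsto \operatorname{range}U$, to the $O(d)$-invariant probability measure on the Grassmannian $G(d,k)$. Let $A\subseteq\mathbb{R}^d$ be an arbitrary set. If $\mathrm{N}^\alpha(A)>0$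 for some $\alpha\ge 0$ with $\alpha\ne k$, then for almost every $U\in\mathcal{U}_{d,k}$, \[\mathrm{N}^{\min(k,\alpha)}(UA)>0 .\] In particular, for almost every $U\in\mathcal{U}_{d,k}$, \[\mathrm{cdim}(UA)\ \ge\ \min\big(k,\mathrm{cdim}(A)\big),\] and, if $\mathrm{cdim}(A)>k$, then $\mathrm{N}^k(UA)>0$. -/

import Mathlib

open MeasureTheory Filter
open scoped ENNReal

noncomputable section

namespace CountingDim

/-! ### Counting measures and counting dimension -/

/-- `⌊x⌋`: the vector `x` rounded down in each coordinate. -/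
def floorVec {d : ℕ} (x : EuclideanSpace ℝ (Fin d)) : EuclideanSpace ℝ (Fin d) :=
  WithLp.toLp 2 fun i => ((⌊x i⌋ : ℤ) : ℝ)

/-- The half-open cube `∏ i, [a i, a i + ℓ)` based at `a` with side length `ℓ`. -/
def cube {d : ℕ} (a : EuclideanSpace ℝ (Fin d)) (ℓ : ℝ) : Set (EuclideanSpace ℝ (Fin d)) :=
  {x | ∀ i, a i ≤ x i ∧ x i < a i + ℓ}

/-- The `α`-counting measure
`limsup_{‖C‖ → ∞} |⌊A⌋ ∩ C| / ‖C‖ ^ α`, over all cubes `C`; a cube is given by the pair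
`(a, ℓ)` of its base point and its side length, and the filter says that `ℓ → ∞`, with no
restriction on `a`. -/
def cmeas {d : ℕ} (α : ℝ) (A : Set (EuclideanSpace ℝ (Fin d))) : ℝ≥0∞ :=
  limsup
    (fun C : EuclideanSpace ℝ (Fin d) × ℝ =>
      ((((floorVec '' A) ∩ cube C.1 C.2).encard : ℕ∞) : ℝ≥0∞) / ENNReal.ofReal (C.2 ^ α))
    (comap Prod.snd atTop)

/-- The counting dimension. The set on the right contains every `α > d`, and is bounded below
by `0`, so the infimum is a genuine one. -/
def cdim {d : ℕ} (A : Set (EuclideanSpace ℝ (Fin d))) : ℝ :=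
  sInf {α : ℝ | 0 ≤ α ∧ cmeas α A = 0}

/-! ### Orthogonal projections of rank `k` and their invariant probability measure -/

/-- The set of orthogonal projections of `ℝ^d` with range of dimension `k`, as a subset of the
space of linear maps with the operator norm. (`IsStarProjection U` says `U ^ 2 = U` and that `U` is
self-adjoint.) Its Borel `σ`-algebra is the one inherited from the space of linear maps. -/
def orthProj (d k : ℕ) : Set (EuclideanSpace ℝ (Fin d) →L[ℝ] EuclideanSpace ℝ (Fin d)) :=
  {U | IsStarProjection U ∧ Module.finrank ℝ U.range = k}

instance instContinuousStarEuclidean (d : ℕ) :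
    ContinuousStar (EuclideanSpace ℝ (Fin d) →L[ℝ] EuclideanSpace ℝ (Fin d)) :=
  ⟨(ContinuousLinearMap.adjoint (𝕜 := ℝ) (E := EuclideanSpace ℝ (Fin d))
    (F := EuclideanSpace ℝ (Fin d))).continuous⟩

/-- The orthogonal group `O(d)`: the linear maps `g` of `ℝ^d` with `g* g = g g* = 1`. -/
abbrev orthGroup (d : ℕ) : Type :=
  unitary (EuclideanSpace ℝ (Fin d) →L[ℝ] EuclideanSpace ℝ (Fin d))

instance instCompactSpaceOrthGroup (d : ℕ) : CompactSpace (orthGroup d) := by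
  apply isCompact_iff_compactSpace.mp
  refine Metric.isCompact_of_isClosed_isBounded isClosed_unitary ?_
  refine (Metric.isBounded_closedBall (x := 0) (r := 1)).subset fun g hg => ?_
  rw [mem_closedBall_zero_iff]
  have h := CStarRing.norm_star_mul_self (x := g)
  rw [Unitary.star_mul_self_of_mem hg] at h
  have h1 : ‖(1 : EuclideanSpace ℝ (Fin d) →L[ℝ] EuclideanSpace ℝ (Fin d))‖ ≤ 1 :=
    ContinuousLinearMap.norm_id_le
  nlinarith [norm_nonneg g]

/-- The Haar probability measure on `O(d)`. -/
def orthHaar (d : ℕ) : Measure (orthGroup d) := Measure.haarMeasure ⊤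

instance instIsProbabilityMeasureOrthHaar (d : ℕ) : IsProbabilityMeasure (orthHaar d) :=
  ⟨by
    have h := Measure.haarMeasure_self (G := orthGroup d) (K₀ := ⊤)
    simpa [orthHaar] using h⟩

/-- `O(d)` acts on the orthogonal projections of rank `k` by `U ↦ g U g⁻¹`; the range of `g U g⁻¹`
is the image under `g` of the range of `U`. -/
def conj {d k : ℕ} (g : orthGroup d) (U : orthProj d k) : orthProj d k :=
  ⟨(g : EuclideanSpace ℝ (Fin d) →L[ℝ] EuclideanSpace ℝ (Fin d)) * U.1 * ((g⁻¹ : orthGroup d) :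
      EuclideanSpace ℝ (Fin d) →L[ℝ] EuclideanSpace ℝ (Fin d)), by
    obtain ⟨⟨hi, hs⟩, hr⟩ := U.2
    have hg : ((g⁻¹ : orthGroup d) : EuclideanSpace ℝ (Fin d) →L[ℝ] EuclideanSpace ℝ (Fin d)) * g
        = 1 := Unitary.coe_star_mul_self g
    have hg' : (g : EuclideanSpace ℝ (Fin d) →L[ℝ] EuclideanSpace ℝ (Fin d)) * (g⁻¹ : orthGroup d)
        = 1 := Unitary.coe_mul_star_self g
    refine ⟨⟨?_, ?_⟩, ?_⟩
    · change _ * _ = _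
      have hi' : U.1 * U.1 = U.1 := hi
      calc _ = (g : EuclideanSpace ℝ (Fin d) →L[ℝ] EuclideanSpace ℝ (Fin d)) * U.1 *
            (((g⁻¹ : orthGroup d) : EuclideanSpace ℝ (Fin d) →L[ℝ] EuclideanSpace ℝ (Fin d)) * g)
              * U.1 * (g⁻¹ : orthGroup d) := by noncomm_ring
        _ = _ := by rw [hg, mul_one, mul_assoc _ U.1 U.1, hi']
    · exact hs.conjugate g.1
    · have hsurj : Function.Surjective ((g⁻¹ : orthGroup d) :
          EuclideanSpace ℝ (Fin d) →L[ℝ] EuclideanSpace ℝ (Fin d)) := fun x =>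
        ⟨g.1 x, DFunLike.congr_fun hg x⟩
      have hinj : Function.Injective (g : EuclideanSpace ℝ (Fin d) →L[ℝ] EuclideanSpace ℝ (Fin d)) :=
        Function.LeftInverse.injective (g := (g⁻¹ : orthGroup d).1)
          fun x => DFunLike.congr_fun hg x
      refine Eq.trans ?_ hr
      have : (g.1 * U.1 * (g⁻¹ : orthGroup d).1).range = U.1.range.map g.1.toLinearMap := by
        ext y
        constructor
        · rintro ⟨x, rfl⟩
          exact ⟨_, ⟨_, rfl⟩, rfl⟩
        · rintro ⟨_, ⟨x, rfl⟩, rfl⟩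
          obtain ⟨z, rfl⟩ := hsurj x
          exact ⟨z, rfl⟩
      rw [this]
      exact (Submodule.equivMapOfInjective g.1.toLinearMap hinj U.1.range).finrank_eq.symm⟩

/-- The orthogonal projection onto `ℝ^k × {0}^(d-k)`, the span of the first `k` basis vectors. -/
def stdProj {d k : ℕ} (hk : k ≤ d) : orthProj d k :=
  ⟨(Submodule.span ℝ (Set.range fun i : Fin k =>
      EuclideanSpace.single (Fin.castLE hk i) (1 : ℝ))).starProjection,
    isStarProjection_starProjection, by
    have h : LinearIndependent ℝ fun i : Fin k =>
        (EuclideanSpace.single (Fin.castLE hk i) (1 : ℝ) : EuclideanSpace ℝ (Fin d)) := by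
      have := ((EuclideanSpace.basisFun (Fin d) ℝ).toBasis.linearIndependent).comp
        (Fin.castLE hk) (Fin.castLE_injective hk)
      simpa [Function.comp_def] using this
    rw [Submodule.range_starProjection]
    simpa using finrank_span_eq_card h⟩

/-- The `O(d)`-invariant Borel probability measure on the orthogonal projections of rank `k`: the
law of the orthogonal projection onto `g (ℝ^k × {0}^(d-k))` for a Haar-distributed `g` in `O(d)`.
Under `U ↦ range U` it is the `O(d)`-invariant probability measure on the Grassmannian `G(d, k)`. -/
def orthProjMeasure {d k : ℕ} (hk : k ≤ d) : Measure (orthProj d k) :=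
  (orthHaar d).map fun g => conj g (stdProj hk)

theorem continuous_conj_left {d k : ℕ} (U : orthProj d k) :
    Continuous fun g : orthGroup d => conj g U :=
  Continuous.subtype_mk ((continuous_subtype_val.mul continuous_const).mul
    (continuous_subtype_val.comp continuous_inv)) _

theorem continuous_conj_right {d k : ℕ} (g : orthGroup d) :
    Continuous fun U : orthProj d k => conj g U :=
  Continuous.subtype_mk ((continuous_const.mul continuous_subtype_val).mul continuous_const) _

instance instIsProbabilityMeasureOrthProjMeasure {d k : ℕ} (hk : k ≤ d) :
    IsProbabilityMeasure (orthProjMeasure hk) :=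
  Measure.isProbabilityMeasure_map (continuous_conj_left _).measurable.aemeasurable

/-- `orthProjMeasure` is invariant under the action of `O(d)`. -/
theorem map_conj_orthProjMeasure {d k : ℕ} (hk : k ≤ d) (g : orthGroup d) :
    (orthProjMeasure hk).map (conj g) = orthProjMeasure hk := by
  have hmul : (orthHaar d).map (fun h => g * h) = orthHaar d := by
    unfold orthHaar
    exact map_mul_left_eq_self _ g
  unfold orthProjMeasure
  rw [Measure.map_map (continuous_conj_right g).measurable (continuous_conj_left _).measurable]
  conv_rhs => rw [← hmul]
  rw [Measure.map_map (continuous_conj_left _).measurable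
    (continuous_const_mul g).measurable]
  congr 1
  funext h
  apply Subtype.ext
  simp only [Function.comp, conj, mul_inv_rev, Submonoid.coe_mul]
  noncomm_ring

end CountingDim

end

/-! This is a discrete form of the energy proof of Marstrand's projection theorem. Put `b = 2 ^ α`.

A discrete Frostman lemma (`exists_regular`) produces, at arbitrarily large scales `2 ^ m`, finite
sets `F ⊆ ⌊A⌋` of diameter below `2 ^ m` with at least `c * b ^ m` points, of which at most `K * b ^
i` lie within `2 ^ i` of any given point, for every `i`.

A random `U` maps `v ≠ 0` into a fixed ball with probability `O(‖v‖ ^ (-k))`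
(`exists_measure_norm_apply_le`). Summing over dyadic distances, the expected number of pairs in `F`
with close images is at most a constant times `|F| * ∑ j ≤ m, (b / 2 ^ k) ^ j`. As `α ≠ k`, the
ratio is not 1 and the sum is `O(σ ^ m)` with `σ = max 1 (b / 2 ^ k)`
(`exists_lintegral_closePairs_le`).

By Fatou, almost every `U` satisfies this bound, up to a constant depending on `U`, at infinitely
many scales. At such a scale Cauchy–Schwarz gives `⌊UA⌋` at least a constant times `|F| / σ ^ m`
points in a cube of side comparable to `2 ^ m` (`exists_cube_of_closePairs_le`), and `b / σ = 2 ^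
min(k, α)`. -/

noncomputable section

namespace CountingDim

/-! ### Regular subsets of finite sets of lattice points -/

/-- The points of `F` in the dyadic cube of side `2 ^ j` with index `q`. -/
def dyadicPart {d : ℕ} (F : Finset (Fin d → ℤ)) (j : ℕ) (q : Fin d → ℤ) : Finset (Fin d → ℤ) :=
  F.filter fun z => ∀ i, z i / 2 ^ j = q i

/-- The points of `F` at sup-distance less than `2 ^ j` from `z`. -/
def near {d : ℕ} (F : Finset (Fin d → ℤ)) (j : ℕ) (z : Fin d → ℤ) : Finset (Fin d → ℤ) :=
  F.filter fun w => ∀ i, |z i - w i| < 2 ^ j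

/-- Take `G` of maximal cardinality among the subsets obeying the growth bound. A point outside `G`
cannot be added, so some dyadic cube around it is full up to one point; as `b ^ j ≥ 1`, that cube
holds at least half of its allowance. For a point of `G`, level 0 works. -/
theorem exists_saturated_subset {d : ℕ} {b : ℝ} (hb : 1 ≤ b) (F : Finset (Fin d → ℤ)) :
    ∃ G ⊆ F, (∀ j q, ((dyadicPart G j q).card : ℝ) ≤ b ^ j) ∧
      ∀ x ∈ F, ∃ j, b ^ j ≤ 2 * ((dyadicPart G j fun i => x i / 2 ^ j).card : ℝ) := by
  classical
  set S : Finset (Finset (Fin d → ℤ)) :=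
    F.powerset.filter fun G => ∀ j q, ((dyadicPart G j q).card : ℝ) ≤ b ^ j with hS
  have hne : S.Nonempty := by
    refine ⟨∅, ?_⟩
    simp only [hS, Finset.mem_filter, Finset.empty_mem_powerset, true_and]
    intro j q
    simp only [dyadicPart, Finset.filter_empty, Finset.card_empty, Nat.cast_zero]
    positivity
  obtain ⟨G, hGS, hmax⟩ := S.exists_max_image Finset.card hne
  obtain ⟨hGF, hG⟩ := Finset.mem_filter.mp hGS
  rw [Finset.mem_powerset] at hGF
  refine ⟨G, hGF, hG, fun x hx => ?_⟩
  by_cases hxG : x ∈ G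
  · refine ⟨0, ?_⟩
    have : 0 < (dyadicPart G 0 fun i => x i / 2 ^ 0).card :=
      Finset.card_pos.mpr ⟨x, by simp [dyadicPart, hxG]⟩
    have : (1 : ℝ) ≤ ((dyadicPart G 0 fun i => x i / 2 ^ 0).card : ℝ) := by exact_mod_cast this
    rw [pow_zero]
    linarith
  · have hnot : insert x G ∉ S := fun h => by
      have := hmax _ h
      rw [Finset.card_insert_of_notMem hxG] at this
      omega
    have hsub : insert x G ⊆ F := Finset.insert_subset hx hGF
    simp only [hS, Finset.mem_filter, Finset.mem_powerset, hsub, true_and, not_forall,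
      not_le] at hnot
    obtain ⟨j, q, hj⟩ := hnot
    refine ⟨j, ?_⟩
    by_cases hq : ∀ i, x i / 2 ^ j = q i
    · have hq' : (fun i => x i / 2 ^ j) = q := funext hq
      have hins : dyadicPart (insert x G) j q = insert x (dyadicPart G j q) := by
        rw [dyadicPart, Finset.filter_insert, if_pos hq, dyadicPart]
      rw [hins] at hj
      have h1 := Finset.card_insert_le x (dyadicPart G j q)
      have h2 : ((insert x (dyadicPart G j q)).card : ℝ) ≤ (dyadicPart G j q).card + 1 := by
        exact_mod_cast h1
      rw [hq']
      have h3 : 1 ≤ b ^ j := one_le_pow₀ hb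
      have h4 : (0 : ℝ) < (dyadicPart G j q).card := by linarith
      have h5 : (1 : ℝ) ≤ (dyadicPart G j q).card := by
        have : 0 < (dyadicPart G j q).card := by exact_mod_cast h4
        exact_mod_cast this
      linarith
    · have hins : dyadicPart (insert x G) j q = dyadicPart G j q := by
        rw [dyadicPart, Finset.filter_insert, if_neg hq, dyadicPart]
      rw [hins] at hj
      exact absurd hj (not_lt.mpr (hG j q))

theorem abs_ediv_sub_le_one {x y : ℤ} {n : ℤ} (hn : 0 < n) (h : |x - y| < n) :
    y / n ∈ Finset.Icc (x / n - 1) (x / n + 1) := by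
  rw [abs_lt] at h
  have h1 := Int.mul_ediv_add_emod x n
  have h2 := Int.mul_ediv_add_emod y n
  have h3 := Int.emod_nonneg x hn.ne'
  have h4 := Int.emod_nonneg y hn.ne'
  have h5 := Int.emod_lt_of_pos x hn
  have h6 := Int.emod_lt_of_pos y hn
  rw [Finset.mem_Icc]
  constructor
  · by_contra! hc
    nlinarith
  · by_contra! hc
    nlinarith

/-- The points near `z` at scale `2 ^ j` lie in the `3 ^ d` dyadic cubes of side `2 ^ j` that
surround or contain `z`. -/
theorem card_near_le {d : ℕ} {b : ℝ} {G : Finset (Fin d → ℤ)}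
    (hG : ∀ j q, ((dyadicPart G j q).card : ℝ) ≤ b ^ j) (j : ℕ) (z : Fin d → ℤ) :
    ((near G j z).card : ℝ) ≤ 3 ^ d * b ^ j := by
  classical
  set Q : Finset (Fin d → ℤ) :=
    Fintype.piFinset fun i => Finset.Icc (z i / 2 ^ j - 1) (z i / 2 ^ j + 1) with hQ
  have hsub : near G j z ⊆ Q.biUnion fun q => dyadicPart G j q := by
    intro w hw
    obtain ⟨hw1, hw2⟩ := Finset.mem_filter.mp hw
    refine Finset.mem_biUnion.mpr ⟨fun i => w i / 2 ^ j, ?_, ?_⟩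
    · exact Fintype.mem_piFinset.mpr fun i => abs_ediv_sub_le_one (by positivity) (hw2 i)
    · exact Finset.mem_filter.mpr ⟨hw1, fun i => rfl⟩
  have hcard : Q.card = 3 ^ d := by
    rw [hQ, Fintype.card_piFinset]
    have : ∀ i, (Finset.Icc (z i / 2 ^ j - 1) (z i / 2 ^ j + 1)).card = 3 := fun i => by
      rw [Int.card_Icc]; omega
    simp [this]
  calc ((near G j z).card : ℝ) ≤ ∑ q ∈ Q, ((dyadicPart G j q).card : ℝ) := by
        exact_mod_cast (Finset.card_le_card hsub).trans Finset.card_biUnion_le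
    _ ≤ ∑ _q ∈ Q, b ^ j := Finset.sum_le_sum fun q _ => hG j q
    _ = 3 ^ d * b ^ j := by rw [Finset.sum_const, hcard, nsmul_eq_mul]; push_cast; ring

theorem abs_sub_lt_of_ediv_eq {x y n : ℤ} (hn : 0 < n) (h : x / n = y / n) : |x - y| < n := by
  have h1 := Int.mul_ediv_add_emod x n
  have h2 := Int.mul_ediv_add_emod y n
  have h3 := Int.emod_nonneg x hn.ne'
  have h4 := Int.emod_nonneg y hn.ne'
  have h5 := Int.emod_lt_of_pos x hn
  have h6 := Int.emod_lt_of_pos y hn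
  rw [h] at h1
  rw [abs_lt]
  constructor <;> linarith

theorem ediv_two_pow_eq {x y : ℤ} {i j : ℕ} (hij : i ≤ j) (h : x / 2 ^ i = y / 2 ^ i) :
    x / 2 ^ j = y / 2 ^ j := by
  obtain ⟨k, rfl⟩ := Nat.exists_eq_add_of_le hij
  rw [pow_add, ← Int.ediv_ediv_of_nonneg (by positivity), h,
    Int.ediv_ediv_of_nonneg (by positivity)]

/-- If every point of `F` were saturated only at levels `≤ J`, the dyadic cubes of side `2 ^ J`
meeting the saturated subset `G` would cover `F`. Then `|F| ≤ 2 ^ (J * d) * |G|`, which is too small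
since `|G| ≤ 3 ^ d * b ^ m`. So some cube of level above `J` is saturated, and its part of `G` is
the required set. -/
theorem exists_regular_subset {d : ℕ} {b : ℝ} (hb : 1 ≤ b) (F : Finset (Fin d → ℤ)) (m J : ℕ)
    (hF : ∀ x ∈ F, ∀ y ∈ F, ∀ i, |x i - y i| < 2 ^ m)
    (hcard : 3 ^ d * (2 ^ J) ^ d * b ^ m < (F.card : ℝ)) :
    ∃ j, J < j ∧ ∃ G ⊆ F, (∀ x ∈ G, ∀ y ∈ G, ∀ i, |x i - y i| < 2 ^ j) ∧
      1 / 2 * b ^ j ≤ (G.card : ℝ) ∧ ∀ i z, ((near G i z).card : ℝ) ≤ 3 ^ d * b ^ i := by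
  classical
  obtain ⟨G, hGF, hG, hsat⟩ := exists_saturated_subset hb F
  have key : ∃ x ∈ F, ∃ j, J < j ∧
      b ^ j ≤ 2 * ((dyadicPart G j fun i => x i / 2 ^ j).card : ℝ) := by
    by_contra! hcon
    have hsub : F ⊆ G.biUnion fun y => Fintype.piFinset fun i =>
        Finset.Ico (2 ^ J * (y i / 2 ^ J)) (2 ^ J * (y i / 2 ^ J) + 2 ^ J) := by
      intro x hx
      obtain ⟨j, hj⟩ := hsat x hx
      have hjJ : j ≤ J := by
        by_contra! h
        exact absurd hj (not_le.mpr (hcon x hx j h))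
      have hpos : (0 : ℝ) < (dyadicPart G j fun i => x i / 2 ^ j).card := by
        have : 1 ≤ b ^ j := one_le_pow₀ hb
        linarith
      obtain ⟨y, hy⟩ := Finset.card_pos.mp (Nat.cast_pos.mp hpos)
      obtain ⟨hyG, hy2⟩ := Finset.mem_filter.mp hy
      refine Finset.mem_biUnion.mpr ⟨y, hyG, Fintype.mem_piFinset.mpr fun i => ?_⟩
      rw [ediv_two_pow_eq hjJ (hy2 i), Finset.mem_Ico]
      have hn : (0 : ℤ) < 2 ^ J := by positivity
      have h1 := Int.mul_ediv_add_emod (x i) (2 ^ J)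
      have h3 := Int.emod_nonneg (x i) hn.ne'
      have h5 := Int.emod_lt_of_pos (x i) hn
      constructor <;> linarith
    have h1 : F.card ≤ G.card * (2 ^ J) ^ d := by
      refine (Finset.card_le_card hsub).trans (Finset.card_biUnion_le_card_mul _ _ _ fun y _ => ?_)
      rw [Fintype.card_piFinset]
      have hJ : ((2 : ℤ) ^ J).toNat = 2 ^ J := by
        rw [Int.toNat_pow_of_nonneg (by norm_num)]
        rfl
      simp [hJ]
    have hFne : F.Nonempty := by
      rw [← Finset.card_pos]
      have : (0 : ℝ) < F.card := lt_of_le_of_lt (by positivity) hcard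
      exact_mod_cast this
    obtain ⟨x, hx⟩ := hFne
    have h2 : near G m x = G :=
      Finset.filter_true_of_mem fun y hy => hF x hx y (hGF hy)
    have h3 := card_near_le hG m x
    rw [h2] at h3
    have h4 : (F.card : ℝ) ≤ G.card * (2 ^ J) ^ d := by exact_mod_cast h1
    have h5 : (G.card : ℝ) * (2 ^ J) ^ d ≤ 3 ^ d * b ^ m * (2 ^ J) ^ d := by gcongr
    nlinarith
  obtain ⟨x, hx, j, hJj, hj⟩ := key
  refine ⟨j, hJj, dyadicPart G j fun i => x i / 2 ^ j, (Finset.filter_subset _ _).trans hGF,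
    ?_, by linarith, fun i z => ?_⟩
  · intro y hy z hz i
    exact abs_sub_lt_of_ediv_eq (by positivity)
      (((Finset.mem_filter.mp hy).2 i).trans ((Finset.mem_filter.mp hz).2 i).symm)
  · refine le_trans ?_ (card_near_le hG i z)
    exact_mod_cast Finset.card_le_card (Finset.filter_subset_filter _ (Finset.filter_subset _ _))

/-! ### Counting lattice points -/

/-- The lattice points `z` such that `z = ⌊x⌋` for some `x ∈ A`. -/
def latticeSet {d : ℕ} (A : Set (EuclideanSpace ℝ (Fin d))) : Set (Fin d → ℤ) :=
  {z | ∃ x ∈ A, ∀ i, ⌊x i⌋ = z i}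

/-- The lattice points in the cube `∏ i, [a i, a i + ℓ)`. -/
def cubePoints {d : ℕ} (a : Fin d → ℝ) (ℓ : ℝ) : Finset (Fin d → ℤ) :=
  Fintype.piFinset fun i => Finset.Ico ⌈a i⌉ ⌈a i + ℓ⌉

open Classical in
/-- The elements of `⌊A⌋` in the cube `∏ i, [a i, a i + ℓ)`. -/
def latticePoints {d : ℕ} (A : Set (EuclideanSpace ℝ (Fin d))) (a : Fin d → ℝ) (ℓ : ℝ) :
    Finset (Fin d → ℤ) :=
  (cubePoints a ℓ).filter (· ∈ latticeSet A)

theorem mem_latticePoints {d : ℕ} {A : Set (EuclideanSpace ℝ (Fin d))} {a : Fin d → ℝ} {ℓ : ℝ}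
    {z : Fin d → ℤ} :
    z ∈ latticePoints A a ℓ ↔ (∀ i, a i ≤ z i ∧ (z i : ℝ) < a i + ℓ) ∧ z ∈ latticeSet A := by
  simp [latticePoints, cubePoints, Fintype.mem_piFinset, Int.ceil_le, Int.lt_ceil]

theorem encard_floorVec_inter_cube {d : ℕ} (A : Set (EuclideanSpace ℝ (Fin d)))
    (a : EuclideanSpace ℝ (Fin d)) (ℓ : ℝ) :
    (floorVec '' A ∩ cube a ℓ).encard = (latticePoints A a ℓ).card := by
  have hinj : Function.Injective fun z : Fin d → ℤ =>
      (WithLp.toLp 2 fun i => (z i : ℝ) : EuclideanSpace ℝ (Fin d)) := by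
    intro z w h
    funext i
    have := congrArg (fun x : EuclideanSpace ℝ (Fin d) => x i) h
    simpa using this
  have himg : floorVec '' A ∩ cube a ℓ = (fun z : Fin d → ℤ =>
      (WithLp.toLp 2 fun i => (z i : ℝ) : EuclideanSpace ℝ (Fin d))) '' latticePoints A a ℓ := by
    ext y
    constructor
    · rintro ⟨⟨x, hx, rfl⟩, hy⟩
      exact ⟨fun i => ⌊x i⌋, mem_latticePoints.mpr ⟨hy, x, hx, fun i => rfl⟩, rfl⟩
    · rintro ⟨z, hz, rfl⟩
      obtain ⟨h1, x, hx, h2⟩ := mem_latticePoints.mp hz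
      refine ⟨⟨x, hx, ?_⟩, h1⟩
      simp only [floorVec, h2]
  rw [himg, hinj.encard_image, Set.encard_coe_eq_coe_finsetCard]

/-- Replaces the extended-valued limsup by real inequalities on finite counts, the form used in all
later arguments. -/
theorem cmeas_pos_iff {d : ℕ} {α : ℝ} {A : Set (EuclideanSpace ℝ (Fin d))} :
    0 < cmeas α A ↔ ∃ c : ℝ, 0 < c ∧ ∀ L : ℝ, ∃ a : Fin d → ℝ, ∃ ℓ : ℝ, L ≤ ℓ ∧
      c * ℓ ^ α ≤ ((latticePoints A a ℓ).card : ℝ) := by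
  unfold cmeas
  simp only [encard_floorVec_inter_cube]
  constructor
  · intro h
    obtain ⟨c, hc0, hc⟩ := exists_between h
    have hfreq := frequently_lt_of_lt_limsup (by isBoundedDefault) hc
    refine ⟨c.toReal, ENNReal.toReal_pos hc0.ne' hc.ne_top, fun L => ?_⟩
    have hev : ∀ᶠ C : EuclideanSpace ℝ (Fin d) × ℝ in comap Prod.snd atTop, max L 1 ≤ C.2 :=
      tendsto_comap.eventually (eventually_ge_atTop (max L 1))
    obtain ⟨⟨a, ℓ⟩, h1, h2⟩ := (hfreq.and_eventually hev).exists
    have hℓ : 0 < ℓ := lt_of_lt_of_le one_pos ((le_max_right _ _).trans h2)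
    refine ⟨a, ℓ, (le_max_left _ _).trans h2, ?_⟩
    have hp : 0 < ℓ ^ α := Real.rpow_pos_of_pos hℓ α
    have h3 := h1.le
    rw [ENNReal.le_div_iff_mul_le (Or.inl (by simpa using hp)) (Or.inl ENNReal.ofReal_ne_top)] at h3
    have h4 := ENNReal.toReal_mono (by simp) h3
    rw [ENNReal.toReal_mul, ENNReal.toReal_ofReal hp.le] at h4
    simpa using h4
  · rintro ⟨c, hc, h⟩
    refine lt_of_lt_of_le (ENNReal.ofReal_pos.mpr hc)
      (le_limsup_of_frequently_le ?_ (by isBoundedDefault))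
    intro hev
    rw [eventually_comap] at hev
    obtain ⟨L, hL⟩ := eventually_atTop.mp hev
    obtain ⟨a, ℓ, h1, h2⟩ := h (max L 1)
    have hℓ : 0 < ℓ := lt_of_lt_of_le one_pos ((le_max_right _ _).trans h1)
    have hp : 0 < ℓ ^ α := Real.rpow_pos_of_pos hℓ α
    refine hL ℓ ((le_max_left _ _).trans h1) (WithLp.toLp 2 a, ℓ) rfl ?_
    beta_reduce
    rw [ENNReal.le_div_iff_mul_le (Or.inl (by simpa using hp)) (Or.inl ENNReal.ofReal_ne_top),
      ← ENNReal.ofReal_mul hc.le]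
    simpa using ENNReal.ofReal_le_ofReal h2

/-- A set of positive `α`-counting measure has, at arbitrarily large scales, finite sets of lattice
points of size comparable to the `α`-th power of the scale and with the corresponding growth bound
at all smaller scales. -/
theorem exists_regular {d : ℕ} {α : ℝ} (hα : 0 ≤ α) {A : Set (EuclideanSpace ℝ (Fin d))}
    (hA : 0 < cmeas α A) :
    ∃ c K : ℝ, 0 < c ∧ 0 ≤ K ∧ ∀ L : ℕ, ∃ m, L ≤ m ∧ ∃ F : Finset (Fin d → ℤ),
      (F : Set (Fin d → ℤ)) ⊆ latticeSet A ∧ (∀ x ∈ F, ∀ y ∈ F, ∀ i, |x i - y i| < 2 ^ m) ∧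
      c * ((2 : ℝ) ^ α) ^ m ≤ F.card ∧
      ∀ i z, ((near F i z).card : ℝ) ≤ K * ((2 : ℝ) ^ α) ^ i := by
  classical
  set b : ℝ := (2 : ℝ) ^ α with hbdef
  have hb : 1 ≤ b := Real.one_le_rpow (by norm_num) hα
  have hb0 : 0 < b := by linarith
  have hpow : ∀ n : ℕ, ((2 : ℝ) ^ n) ^ α = b ^ n := fun n => by
    rw [hbdef, ← Real.rpow_natCast, ← Real.rpow_natCast, ← Real.rpow_mul (by norm_num),
      ← Real.rpow_mul (by norm_num), mul_comm]
  have hdiam : ∀ (a : Fin d → ℝ) (ℓ : ℝ) (n : ℕ), ℓ ≤ 2 ^ n → ∀ x ∈ latticePoints A a ℓ,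
      ∀ y ∈ latticePoints A a ℓ, ∀ i, |x i - y i| < 2 ^ n := by
    intro a ℓ n hn x hx y hy i
    have h1 := (mem_latticePoints.mp hx).1 i
    have h2 := (mem_latticePoints.mp hy).1 i
    have : |(x i : ℝ) - y i| < 2 ^ n := by
      rw [abs_lt]
      constructor <;> linarith
    exact_mod_cast this
  -- If counts at all large dyadic scales are `O(b ^ j)`, the points of `⌊A⌋` in a cube with many
  -- points already form a regular set. Otherwise some cubes are overfull by any factor, and a
  -- regular subset has to be extracted.
  by_cases hbd : ∃ (K : ℝ) (J : ℕ), ∀ j, J ≤ j → ∀ a : Fin d → ℝ,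
      ((latticePoints A a (2 ^ j)).card : ℝ) ≤ K * b ^ j
  · obtain ⟨K, J, hK⟩ := hbd
    obtain ⟨c, hc, hcA⟩ := cmeas_pos_iff.mp hA
    have hK0 : 0 ≤ K := by
      have h1 := hK J le_rfl 0
      have h2 : (0 : ℝ) ≤ K * b ^ J := le_trans (Nat.cast_nonneg _) h1
      exact nonneg_of_mul_nonneg_left h2 (by positivity)
    -- The side `ℓ` is rounded up to a power of 2, which costs a factor `b`. A neighbourhood at
    -- scale `2 ^ i` is enlarged to a cube of side `2 ^ (i + 1 + J)`, so that `hK` applies also when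
    -- `i < J`.
    refine ⟨c / b, K * b ^ (J + 1), by positivity, by positivity, fun L => ?_⟩
    obtain ⟨a, ℓ, hℓ, hcard⟩ := hcA (2 ^ L)
    have hℓ1 : 1 ≤ ℓ := (one_le_pow₀ (by norm_num)).trans hℓ
    obtain ⟨n, hn1, hn2⟩ := exists_nat_pow_near hℓ1 (one_lt_two (α := ℝ))
    refine ⟨n + 1, ?_, latticePoints A a ℓ, fun z hz => (mem_latticePoints.mp hz).2,
      hdiam a ℓ _ hn2.le, ?_, fun i z => ?_⟩
    · have : (2 : ℝ) ^ L < 2 ^ (n + 1) := lt_of_le_of_lt hℓ hn2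
      exact ((pow_lt_pow_iff_right₀ (one_lt_two (α := ℝ))).mp this).le
    · refine le_trans ?_ hcard
      have : b ^ n ≤ ℓ ^ α := by
        rw [← hpow]
        exact Real.rpow_le_rpow (by positivity) hn1 hα
      calc c / b * b ^ (n + 1) = c * b ^ n := by rw [pow_succ]; field_simp
        _ ≤ c * ℓ ^ α := by gcongr
    · have hsub : near (latticePoints A a ℓ) i z ⊆
          latticePoints A (fun s => (z s : ℝ) - 2 ^ i) (2 ^ (i + 1 + J)) := by
        intro w hw
        obtain ⟨hw1, hw2⟩ := Finset.mem_filter.mp hw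
        rw [mem_latticePoints]
        refine ⟨fun s => ?_, (mem_latticePoints.mp hw1).2⟩
        have h1 : |(z s : ℝ) - w s| < 2 ^ i := by exact_mod_cast hw2 s
        have h2 : (2 : ℝ) ^ (i + 1) ≤ 2 ^ (i + 1 + J) :=
          pow_le_pow_right₀ (by norm_num) (by omega)
        rw [pow_succ] at h2
        rw [abs_lt] at h1
        constructor <;> linarith
      refine (Nat.cast_le.mpr (Finset.card_le_card hsub)).trans
        ((hK _ (by omega) _).trans (le_of_eq ?_))
      ring
  · push Not at hbd
    refine ⟨1 / 2, 3 ^ d, by norm_num, by positivity, fun L => ?_⟩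
    obtain ⟨j, -, a, ha⟩ := hbd (3 ^ d * (2 ^ L) ^ d) 0
    obtain ⟨m, hm, G, hGF, h1, h2, h3⟩ := exists_regular_subset hb _ j L (hdiam a _ j le_rfl) ha
    exact ⟨m, hm.le, G, fun z hz => (mem_latticePoints.mp (hGF hz)).2, h1, h2, h3⟩

/-! ### The probability that a random projection of a vector is short -/

instance instSecondCountableOrthProj (d k : ℕ) : SecondCountableTopology (orthProj d k) :=
  haveI : ProperSpace (EuclideanSpace ℝ (Fin d) →L[ℝ] EuclideanSpace ℝ (Fin d)) :=
    FiniteDimensional.proper ℝ _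
  inferInstance

theorem continuous_norm_apply (d k : ℕ) :
    Continuous fun p : orthProj d k × EuclideanSpace ℝ (Fin d) => ‖p.1.1 p.2‖ :=
  ((continuous_subtype_val.comp continuous_fst).clm_apply continuous_snd).norm

theorem measurableSet_norm_apply_le {d k : ℕ} (x : EuclideanSpace ℝ (Fin d)) (ε : ℝ) :
    MeasurableSet {U : orthProj d k | ‖U.1 x‖ ≤ ε} :=
  (isClosed_le ((continuous_norm_apply d k).comp (Continuous.prodMk_left x))
    continuous_const).measurableSet

theorem norm_orthGroup_apply {d : ℕ} (g : orthGroup d) (x : EuclideanSpace ℝ (Fin d)) :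
    ‖g.1 x‖ = ‖x‖ :=
  (Unitary.linearIsometryEquiv g).norm_map x

theorem inv_orthGroup_apply {d : ℕ} (g : orthGroup d) (x : EuclideanSpace ℝ (Fin d)) :
    (g⁻¹ : orthGroup d).1 (g.1 x) = x :=
  DFunLike.congr_fun (Unitary.coe_star_mul_self g) x

theorem exists_orthGroup_apply_eq {d : ℕ} {x y : EuclideanSpace ℝ (Fin d)} (h : ‖x‖ = ‖y‖) :
    ∃ g : orthGroup d, g.1 x = y :=
  ⟨Unitary.linearIsometryEquiv.symm ((ℝ ∙ (x - y))ᗮ.reflection),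
    Submodule.reflection_sub h⟩

/-- Vectors of equal norm are exchanged by a reflection, and the measure is invariant under
conjugation by it. -/
theorem measure_norm_apply_le_congr {d k : ℕ} (hk : k ≤ d) {x y : EuclideanSpace ℝ (Fin d)}
    (h : ‖x‖ = ‖y‖) (ε : ℝ) :
    orthProjMeasure hk {U | ‖U.1 x‖ ≤ ε} = orthProjMeasure hk {U | ‖U.1 y‖ ≤ ε} := by
  obtain ⟨g, rfl⟩ := exists_orthGroup_apply_eq h
  conv_rhs => rw [← map_conj_orthProjMeasure hk g]
  rw [Measure.map_apply (continuous_conj_right g).measurable (measurableSet_norm_apply_le _ _)]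
  congr 1
  ext U
  have : (conj g U).1 (g.1 x) = g.1 (U.1 x) := by
    change g.1 (U.1 ((g⁻¹ : orthGroup d).1 (g.1 x))) = _
    rw [inv_orthGroup_apply]
  simp only [Set.mem_ofPred_eq, Set.mem_preimage, this, norm_orthGroup_apply]

theorem abs_apply_le_norm_stdProj {d k : ℕ} (hk : k ≤ d) (x : EuclideanSpace ℝ (Fin d))
    {i : Fin d} (hi : (i : ℕ) < k) : |x i| ≤ ‖(stdProj hk).1 x‖ := by
  set V := Submodule.span ℝ (Set.range fun i : Fin k =>
      (EuclideanSpace.single (Fin.castLE hk i) (1 : ℝ) : EuclideanSpace ℝ (Fin d))) with hV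
  have hmem : (EuclideanSpace.single i (1 : ℝ) : EuclideanSpace ℝ (Fin d)) ∈ V :=
    Submodule.subset_span ⟨⟨i, hi⟩, rfl⟩
  have h1 : inner ℝ (EuclideanSpace.single i (1 : ℝ)) (V.starProjection x) = x i := by
    rw [← Submodule.inner_starProjection_left_eq_right,
      Submodule.starProjection_eq_self_iff.mpr hmem, EuclideanSpace.inner_single_left]
    simp
  calc |x i| = |inner ℝ (EuclideanSpace.single i (1 : ℝ)) (V.starProjection x)| := by rw [h1]
    _ ≤ ‖(EuclideanSpace.single i (1 : ℝ) : EuclideanSpace ℝ (Fin d))‖ * ‖V.starProjection x‖ :=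
      abs_real_inner_le_norm _ _
    _ = ‖(stdProj hk).1 x‖ := by simp [stdProj, hV]

/-- The set lies in a box with `k` sides of length `2 * ε` and `d - k` sides of length 2. -/
theorem volume_stdProj_le {d k : ℕ} (hk : k ≤ d) {ε : ℝ} (hε : 0 ≤ ε) :
    volume {x : EuclideanSpace ℝ (Fin d) | ‖x‖ ≤ 1 ∧ ‖(stdProj hk).1 x‖ ≤ ε} ≤
      ENNReal.ofReal (2 ^ d * ε ^ k) := by
  set r : Fin d → ℝ := fun i => if (i : ℕ) < k then ε else 1 with hr
  have hr0 : ∀ i, 0 ≤ r i := fun i => by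
    simp only [hr]; split_ifs <;> positivity
  have hsub : {x : EuclideanSpace ℝ (Fin d) | ‖x‖ ≤ 1 ∧ ‖(stdProj hk).1 x‖ ≤ ε} ⊆
      (WithLp.ofLp : EuclideanSpace ℝ (Fin d) → Fin d → ℝ) ⁻¹'
        Set.univ.pi fun i => Set.Icc (-r i) (r i) := by
    rintro x ⟨hx1, hx2⟩ i -
    rw [Set.mem_Icc, ← abs_le]
    simp only [hr]
    split_ifs with hi
    · exact (abs_apply_le_norm_stdProj hk x hi).trans hx2
    · exact (PiLp.norm_apply_le x i).trans hx1
  refine (measure_mono hsub).trans ?_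
  rw [(PiLp.volume_preserving_ofLp (Fin d)).measure_preimage
    (MeasurableSet.univ_pi fun i => measurableSet_Icc).nullMeasurableSet, volume_pi_pi]
  simp only [Real.volume_Icc]
  rw [← ENNReal.ofReal_prod_of_nonneg fun i _ => by linarith [hr0 i]]
  refine ENNReal.ofReal_le_ofReal (le_of_eq ?_)
  calc ∏ i, (r i - -r i) = ∏ i, 2 * r i := Finset.prod_congr rfl fun i _ => by ring
    _ = 2 ^ d * ε ^ k := by
      rw [Finset.prod_mul_distrib, hr, Finset.prod_ite, Finset.prod_const, Finset.prod_const,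
        Finset.prod_const]
      simp [Fin.card_filter_val_lt, hk]

theorem volume_conj_stdProj_le {d k : ℕ} (hk : k ≤ d) (g : orthGroup d) {ε : ℝ} (hε : 0 ≤ ε) :
    volume {x : EuclideanSpace ℝ (Fin d) | ‖x‖ ≤ 1 ∧ ‖(conj g (stdProj hk)).1 x‖ ≤ ε} ≤
      ENNReal.ofReal (2 ^ d * ε ^ k) := by
  have hclosed : MeasurableSet
      {x : EuclideanSpace ℝ (Fin d) | ‖x‖ ≤ 1 ∧ ‖(stdProj hk).1 x‖ ≤ ε} :=
    ((isClosed_le continuous_norm continuous_const).inter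
      (isClosed_le (stdProj hk).1.continuous.norm continuous_const)).measurableSet
  refine le_trans (le_of_eq ?_) (volume_stdProj_le hk hε)
  rw [← (Unitary.linearIsometryEquiv g⁻¹).measurePreserving.measure_preimage
    hclosed.nullMeasurableSet]
  congr 1
  ext x
  have h1 : ‖(Unitary.linearIsometryEquiv g⁻¹) x‖ = ‖x‖ := LinearIsometryEquiv.norm_map _ _
  have h2 : ‖(conj g (stdProj hk)).1 x‖ =
      ‖(stdProj hk).1 ((Unitary.linearIsometryEquiv g⁻¹) x)‖ :=
    norm_orthGroup_apply g ((stdProj hk).1 ((g⁻¹ : orthGroup d).1 x))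
  simp only [Set.mem_preimage, Set.mem_ofPred_eq, h1, h2]

/-- A uniformly random orthogonal projection of rank `k` maps a vector of norm `r` into the ball of
radius `R` with probability `O ((R / r) ^ k)`. -/
theorem exists_measure_norm_apply_le {d k : ℕ} (hk : k ≤ d) :
    ∃ C : ℝ, 0 ≤ C ∧ ∀ R : ℝ, 0 ≤ R → ∀ v : EuclideanSpace ℝ (Fin d), v ≠ 0 →
      orthProjMeasure hk {U | ‖U.1 v‖ ≤ R} ≤ ENNReal.ofReal (C * (R / ‖v‖) ^ k) := by
  set μ := orthProjMeasure hk
  set B : Set (EuclideanSpace ℝ (Fin d)) := Metric.closedBall 0 1 with hB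
  have hBpos : 0 < volume B := Metric.measure_closedBall_pos _ _ one_pos
  have hBfin : volume B ≠ ∞ := measure_closedBall_lt_top.ne
  have hreal : 0 < (volume B).toReal := ENNReal.toReal_pos hBpos.ne' hBfin
  refine ⟨2 ^ d / (volume B).toReal, by positivity, fun R hR v hv => ?_⟩
  have hv0 : 0 < ‖v‖ := norm_pos_iff.mpr hv
  set ε : ℝ := R / ‖v‖ with hε
  have hε0 : 0 ≤ ε := by positivity
  -- By invariance `y` may be replaced by the multiple of `v` of the same norm, which is at most 1.
  have hle : ∀ y ∈ B, μ {U | ‖U.1 v‖ ≤ R} ≤ μ {U | ‖U.1 y‖ ≤ ε} := by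
    intro y hy
    rw [hB, mem_closedBall_zero_iff] at hy
    have hnorm : ‖y‖ = ‖(‖y‖ / ‖v‖) • v‖ := by
      rw [norm_smul, Real.norm_of_nonneg (by positivity), div_mul_cancel₀ _ hv0.ne']
    rw [measure_norm_apply_le_congr hk hnorm]
    refine measure_mono fun U hU => ?_
    simp only [Set.mem_ofPred_eq, map_smul, norm_smul] at hU ⊢
    rw [Real.norm_of_nonneg (by positivity)]
    calc ‖y‖ / ‖v‖ * ‖U.1 v‖ ≤ 1 / ‖v‖ * R := by gcongr
      _ = ε := by rw [hε]; ring
  -- The measure of `S` is computed in both orders. For fixed `U` the slice has volume `O(ε ^ k)`;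
  -- for fixed `y` in the unit ball its probability is at least the one to be bounded.
  set S : Set (orthProj d k × EuclideanSpace ℝ (Fin d)) := {p | ‖p.2‖ ≤ 1 ∧ ‖p.1.1 p.2‖ ≤ ε}
  have hS : MeasurableSet S :=
    ((isClosed_le continuous_snd.norm continuous_const).inter
      (isClosed_le (continuous_norm_apply d k) continuous_const)).measurableSet
  have h1 : (μ.prod volume) S ≤ ENNReal.ofReal (2 ^ d * ε ^ k) := by
    rw [Measure.prod_apply hS]
    have hm : Measurable fun U : orthProj d k => volume (Prod.mk U ⁻¹' S) :=
      measurable_measure_prodMk_left hS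
    change ∫⁻ U, volume (Prod.mk U ⁻¹' S) ∂((orthHaar d).map _) ≤ _
    rw [lintegral_map hm (continuous_conj_left _).measurable]
    calc _ ≤ ∫⁻ _g, ENNReal.ofReal (2 ^ d * ε ^ k) ∂(orthHaar d) :=
          lintegral_mono fun g => volume_conj_stdProj_le hk g hε0
      _ = _ := by simp
  have h2 : volume B * μ {U | ‖U.1 v‖ ≤ R} ≤ (μ.prod volume) S := by
    rw [Measure.prod_apply_symm hS, mul_comm, ← setLIntegral_const]
    refine (setLIntegral_mono_ae' measurableSet_closedBall (ae_of_all _ fun y hy => ?_)).trans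
      (setLIntegral_le_lintegral B _)
    refine (hle y hy).trans (measure_mono fun U hU => ?_)
    exact ⟨mem_closedBall_zero_iff.mp hy, hU⟩
  have h3 := h2.trans h1
  rw [mul_comm, ← ENNReal.le_div_iff_mul_le (Or.inl hBpos.ne') (Or.inl hBfin)] at h3
  refine h3.trans (le_of_eq ?_)
  rw [div_mul_eq_mul_div, ENNReal.ofReal_div_of_pos hreal, ENNReal.ofReal_toReal hBfin]

/-! ### Counting pairs with close projections -/

/-- A lattice point as a vector. -/
def latticeVec {d : ℕ} (z : Fin d → ℤ) : EuclideanSpace ℝ (Fin d) :=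
  WithLp.toLp 2 fun i => (z i : ℝ)

theorem norm_le_of_forall_abs_le {d : ℕ} {x : EuclideanSpace ℝ (Fin d)} {t : ℝ} (ht : 0 ≤ t)
    (h : ∀ i, |x i| ≤ t) : ‖x‖ ≤ d * t := by
  refine abs_le_of_sq_le_sq' ?_ (by positivity) |>.2
  rw [EuclideanSpace.norm_sq_eq]
  have hd : (d : ℝ) ≤ d ^ 2 := by exact_mod_cast Nat.le_self_pow two_ne_zero d
  calc ∑ i, ‖x i‖ ^ 2 ≤ ∑ _i : Fin d, t ^ 2 := Finset.sum_le_sum fun i _ => by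
        rw [Real.norm_eq_abs]; exact pow_le_pow_left₀ (abs_nonneg _) (h i) 2
    _ = d * t ^ 2 := by simp
    _ ≤ d ^ 2 * t ^ 2 := by gcongr
    _ = (d * t) ^ 2 := by ring

theorem norm_orthProj_apply_le {d k : ℕ} (U : orthProj d k) (x : EuclideanSpace ℝ (Fin d)) :
    ‖U.1 x‖ ≤ ‖x‖ := by
  refine (U.1.le_opNorm x).trans ?_
  have : ‖U.1‖ ≤ 1 := U.2.1.norm_le
  nlinarith [norm_nonneg x]

/-- Only the smallest admissible `j` is needed. The sum over all scales is used because, summed over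
`w`, it turns into the counts `near F j z`. -/
theorem exists_measure_lattice_le {d k : ℕ} (hk : k ≤ d) {R : ℝ} (hR : 0 ≤ R) :
    ∃ C : ℝ, 0 < C ∧ ∀ (m : ℕ) (z w : Fin d → ℤ), (∀ i, |z i - w i| < 2 ^ m) →
      orthProjMeasure hk {U | ‖U.1 (latticeVec z - latticeVec w)‖ ≤ R} ≤
        ENNReal.ofReal (C * ∑ j ∈ Finset.range (m + 1),
          if ∀ i, |z i - w i| < 2 ^ j then ((1 / 2 : ℝ) ^ k) ^ j else 0) := by
  classical
  obtain ⟨C, hC, hCU⟩ := exists_measure_norm_apply_le hk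
  refine ⟨1 + C * (2 * R) ^ k, by positivity, fun m z w hzw => ?_⟩
  have hex : ∃ j : ℕ, ∀ i, |z i - w i| < 2 ^ j := ⟨m, hzw⟩
  set j := Nat.find hex with hj
  have hjs : ∀ i, |z i - w i| < 2 ^ j := Nat.find_spec hex
  have hjm : j ≤ m := Nat.find_min' hex hzw
  have hterm : ((1 / 2 : ℝ) ^ k) ^ j ≤ ∑ j ∈ Finset.range (m + 1),
      if ∀ i, |z i - w i| < 2 ^ j then ((1 / 2 : ℝ) ^ k) ^ j else 0 := by
    have h := Finset.single_le_sum (s := Finset.range (m + 1))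
      (f := fun j => if ∀ i, |z i - w i| < 2 ^ j then ((1 / 2 : ℝ) ^ k) ^ j else 0)
      (fun i _ => by split_ifs <;> positivity) (Finset.mem_range.mpr (Nat.lt_succ_of_le hjm))
    simpa only [if_pos hjs] using h
  suffices h : orthProjMeasure hk {U | ‖U.1 (latticeVec z - latticeVec w)‖ ≤ R} ≤
      ENNReal.ofReal ((1 + C * (2 * R) ^ k) * ((1 / 2 : ℝ) ^ k) ^ j) from
    h.trans (ENNReal.ofReal_le_ofReal (by gcongr))
  have hCR : 0 ≤ C * (2 * R) ^ k := by positivity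
  rcases Nat.eq_zero_or_pos j with h0 | hpos
  -- Here `z = w`, and the trivial bound accounts for the summand 1 in the constant.
  · refine prob_le_one.trans ?_
    rw [h0, pow_zero, mul_one, ENNReal.one_le_ofReal]
    linarith
  · have hnot := Nat.find_min hex (m := j - 1) (by omega)
    push Not at hnot
    obtain ⟨i, hi⟩ := hnot
    have hi' : (2 : ℝ) ^ (j - 1) ≤ |(z i : ℝ) - w i| := by exact_mod_cast hi
    have hnorm : (2 : ℝ) ^ (j - 1) ≤ ‖latticeVec z - latticeVec w‖ :=
      hi'.trans (PiLp.norm_apply_le (latticeVec z - latticeVec w) i)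
    have hp : (0 : ℝ) < 2 ^ (j - 1) := by positivity
    have hv : latticeVec z - latticeVec w ≠ 0 := norm_pos_iff.mp (hp.trans_le hnorm)
    refine (hCU R hR _ hv).trans (ENNReal.ofReal_le_ofReal ?_)
    calc C * (R / ‖latticeVec z - latticeVec w‖) ^ k ≤ C * (R / 2 ^ (j - 1)) ^ k := by gcongr
      _ = C * (2 * R) ^ k * ((1 / 2 : ℝ) ^ k) ^ j := by
        have h2 : R / 2 ^ (j - 1) = (2 * R) * (1 / 2) ^ j := by
          obtain ⟨n, hn⟩ : ∃ n, j = n + 1 := ⟨j - 1, by omega⟩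
          rw [hn, Nat.add_sub_cancel, pow_succ, one_div_pow]
          field_simp
        rw [h2, mul_pow, mul_assoc, pow_right_comm]
      _ ≤ _ := by
        gcongr
        linarith

/-- This is where `α ≠ k` enters: for `ρ = 1` the sum is `m + 1`, a logarithmic loss in the scale.
-/
theorem exists_geom_sum_le {ρ : ℝ} (hρ : 0 < ρ) (hρ1 : ρ ≠ 1) :
    ∃ D : ℝ, 0 < D ∧ ∀ m : ℕ, ∑ j ∈ Finset.range (m + 1), ρ ^ j ≤ D * (max 1 ρ) ^ m := by
  rcases lt_or_gt_of_ne hρ1 with h | h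
  · refine ⟨1 / (1 - ρ), by apply one_div_pos.mpr; linarith, fun m => ?_⟩
    rw [max_eq_left h.le, one_pow, mul_one, geom_sum_eq hρ1, ← neg_div_neg_eq]
    have : 0 < ρ ^ (m + 1) := by positivity
    rw [neg_sub, neg_sub]
    have : 0 < 1 - ρ := by linarith
    gcongr
    linarith
  · have : 0 < ρ - 1 := by linarith
    refine ⟨ρ / (ρ - 1), by positivity, fun m => ?_⟩
    rw [max_eq_right h.le, geom_sum_eq hρ1, div_mul_eq_mul_div]
    gcongr
    rw [pow_succ]
    linarith

/-- The number of pairs of points of `F` whose images under `U` are at distance at most `R`. -/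
def closePairs {d k : ℕ} (F : Finset (Fin d → ℤ)) (R : ℝ) (U : orthProj d k) : ℝ≥0∞ :=
  ∑ z ∈ F, ∑ w ∈ F,
    {U : orthProj d k | ‖U.1 (latticeVec z - latticeVec w)‖ ≤ R}.indicator 1 U

theorem measurable_closePairs {d k : ℕ} (F : Finset (Fin d → ℤ)) (R : ℝ) :
    Measurable (closePairs (k := k) F R) :=
  Finset.measurable_fun_sum _ fun _ _ => Finset.measurable_fun_sum _ fun _ _ =>
    measurable_one.indicator (measurableSet_norm_apply_le _ _)

/-- For fixed `z`, scale `j` contributes at most a constant times `b ^ j` neighbours, each weighted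
by `2 ^ (-k * j)`; this leaves a geometric sum of ratio `b / 2 ^ k`. -/
theorem exists_lintegral_closePairs_le {d k : ℕ} (hk : k ≤ d) {R b K : ℝ} (hR : 0 ≤ R)
    (hb : 0 < b) (hbk : b ≠ 2 ^ k) (hK : 0 ≤ K) :
    ∃ C : ℝ, 0 ≤ C ∧ ∀ (m : ℕ) (F : Finset (Fin d → ℤ)),
      (∀ x ∈ F, ∀ y ∈ F, ∀ i, |x i - y i| < 2 ^ m) →
      (∀ i z, ((near F i z).card : ℝ) ≤ K * b ^ i) →
      ∫⁻ U, closePairs F R U ∂(orthProjMeasure hk) ≤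
        ENNReal.ofReal (C * (F.card * (max 1 (b / 2 ^ k)) ^ m)) := by
  classical
  obtain ⟨C, hC, hCm⟩ := exists_measure_lattice_le hk hR
  obtain ⟨D, hD, hDm⟩ := exists_geom_sum_le (ρ := b / 2 ^ k) (by positivity)
    (by rwa [ne_eq, div_eq_one_iff_eq (by positivity)])
  refine ⟨C * (K * D), by positivity, fun m F hF hnear => ?_⟩
  have hind : ∀ z w : Fin d → ℤ, Measurable
      ({U : orthProj d k | ‖U.1 (latticeVec z - latticeVec w)‖ ≤ R}.indicator
        (1 : orthProj d k → ℝ≥0∞)) := fun z w =>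
    measurable_one.indicator (measurableSet_norm_apply_le _ _)
  have hrow : ∀ z ∈ F, ∑ w ∈ F, orthProjMeasure hk
      {U | ‖U.1 (latticeVec z - latticeVec w)‖ ≤ R} ≤
        ENNReal.ofReal (C * (K * (D * (max 1 (b / 2 ^ k)) ^ m))) := by
    intro z hz
    calc _ ≤ ∑ w ∈ F, ENNReal.ofReal (C * ∑ j ∈ Finset.range (m + 1),
          if ∀ i, |z i - w i| < 2 ^ j then ((1 / 2 : ℝ) ^ k) ^ j else 0) :=
          Finset.sum_le_sum fun w hw => hCm m z w (hF z hz w hw)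
      _ = ENNReal.ofReal (∑ w ∈ F, C * ∑ j ∈ Finset.range (m + 1),
          if ∀ i, |z i - w i| < 2 ^ j then ((1 / 2 : ℝ) ^ k) ^ j else 0) := by
          rw [ENNReal.ofReal_sum_of_nonneg]
          intro w _
          exact mul_nonneg hC.le (Finset.sum_nonneg fun j _ => by split_ifs <;> positivity)
      _ ≤ _ := by
          refine ENNReal.ofReal_le_ofReal ?_
          rw [← Finset.mul_sum, Finset.sum_comm]
          refine mul_le_mul_of_nonneg_left ?_ hC.le
          calc _ = ∑ j ∈ Finset.range (m + 1), ((near F j z).card : ℝ) * ((1 / 2 : ℝ) ^ k) ^ j :=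
                Finset.sum_congr rfl fun j _ => by
                  rw [← Finset.sum_filter, Finset.sum_const, nsmul_eq_mul, near]
            _ ≤ ∑ j ∈ Finset.range (m + 1), K * (b / 2 ^ k) ^ j := by
                refine Finset.sum_le_sum fun j _ => ?_
                calc _ ≤ K * b ^ j * ((1 / 2 : ℝ) ^ k) ^ j := by
                      gcongr
                      exact hnear j z
                  _ = K * (b / 2 ^ k) ^ j := by
                      rw [mul_assoc, ← mul_pow, one_div_pow, mul_one_div]
            _ ≤ _ := by
                rw [← Finset.mul_sum]
                exact mul_le_mul_of_nonneg_left (hDm m) hK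
  calc _ = ∑ z ∈ F, ∑ w ∈ F, orthProjMeasure hk
        {U | ‖U.1 (latticeVec z - latticeVec w)‖ ≤ R} := by
        unfold closePairs
        rw [lintegral_finsetSum _ fun z _ => Finset.measurable_fun_sum _ fun w _ => hind z w]
        refine Finset.sum_congr rfl fun z _ => ?_
        rw [lintegral_finsetSum _ fun w _ => hind z w]
        exact Finset.sum_congr rfl fun w _ =>
          lintegral_indicator_one (measurableSet_norm_apply_le _ _)
    _ ≤ ∑ _z ∈ F, ENNReal.ofReal (C * (K * (D * (max 1 (b / 2 ^ k)) ^ m))) :=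
        Finset.sum_le_sum hrow
    _ = _ := by
        rw [Finset.sum_const, nsmul_eq_mul, ← ENNReal.ofReal_natCast,
          ← ENNReal.ofReal_mul (Nat.cast_nonneg _)]
        congr 1
        ring

/-! ### From few close pairs to many points in the projection -/

/-- Cauchy–Schwarz for the fibre sizes: the sum on the right counts colliding pairs, hence is the
sum of their squares. -/
theorem card_sq_le_card_image_mul {β γ : Type*} [DecidableEq γ] (F : Finset β) (φ : β → γ) :
    F.card ^ 2 ≤ (F.image φ).card * ∑ z ∈ F, (F.filter fun w => φ w = φ z).card := by
  have hmaps : ∀ z ∈ F, φ z ∈ F.image φ := fun z hz => Finset.mem_image_of_mem φ hz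
  have h1 : ∑ z ∈ F, (F.filter fun w => φ w = φ z).card =
      ∑ y ∈ F.image φ, (F.filter fun w => φ w = y).card ^ 2 := by
    rw [← Finset.sum_fiberwise_of_maps_to hmaps]
    refine Finset.sum_congr rfl fun y _ => ?_
    rw [sq, ← smul_eq_mul, ← Finset.sum_const]
    refine Finset.sum_congr rfl fun z hz => ?_
    rw [(Finset.mem_filter.mp hz).2]
  rw [h1, Finset.card_eq_sum_card_fiberwise hmaps]
  exact sq_sum_le_card_mul_sum_sq

/-- If few pairs of points of a set of lattice points `F ⊆ ⌊A⌋` have close projections, then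
`⌊U A⌋` has many points in a cube of size comparable to that of `F`. -/
theorem exists_cube_of_closePairs_le {d k : ℕ} {A : Set (EuclideanSpace ℝ (Fin d))}
    (U : orthProj d k) {m : ℕ} {F : Finset (Fin d → ℤ)} (hne : F.Nonempty)
    (hFA : (F : Set (Fin d → ℤ)) ⊆ latticeSet A)
    (hF : ∀ x ∈ F, ∀ y ∈ F, ∀ i, |x i - y i| < 2 ^ m) {T : ℝ} (hT : 0 ≤ T)
    (hU : closePairs F (3 * d) U ≤ ENNReal.ofReal (F.card * T)) :
    ∃ a : Fin d → ℝ, (F.card : ℝ) ≤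
      (latticePoints (U.1 '' A) a ((4 * d + 4) * 2 ^ m)).card * T := by
  classical
  -- Representatives in `A` of the points of `F`; the value 0 off `F` plays no role.
  have hs : ∀ z : Fin d → ℤ, ∃ x : EuclideanSpace ℝ (Fin d), z ∈ F → x ∈ A ∧ ∀ i, ⌊x i⌋ = z i := by
    intro z
    by_cases hz : z ∈ F
    · obtain ⟨x, hx⟩ := hFA hz
      exact ⟨x, fun _ => hx⟩
    · exact ⟨0, fun h => absurd h hz⟩
  choose s hs using hs
  set φ : (Fin d → ℤ) → (Fin d → ℤ) := fun z i => ⌊U.1 (s z) i⌋ with hφ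
  have hsz : ∀ z ∈ F, ∀ i, (z i : ℝ) ≤ s z i ∧ s z i < z i + 1 := by
    intro z hz i
    rw [← (hs z hz).2 i]
    exact ⟨Int.floor_le _, Int.lt_floor_add_one _⟩
  have hround : ∀ z ∈ F, ‖latticeVec z - s z‖ ≤ d := by
    intro z hz
    have := norm_le_of_forall_abs_le (x := latticeVec z - s z) zero_le_one fun i => by
      change |(z i : ℝ) - s z i| ≤ 1
      obtain ⟨h1, h2⟩ := hsz z hz i
      rw [abs_le]
      constructor <;> linarith
    simpa using this
  -- The radius `3 * d` is the sum of three errors of size at most `d`: rounding `s z`, rounding `s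
  -- w`, and the distance between two images in one unit cube.
  have hpair : ∀ z ∈ F, ∀ w ∈ F, φ w = φ z →
      ‖U.1 (latticeVec z - latticeVec w)‖ ≤ 3 * d := by
    intro z hz w hw h
    have h1 : ‖U.1 (s z) - U.1 (s w)‖ ≤ d := by
      have := norm_le_of_forall_abs_le (x := U.1 (s z) - U.1 (s w)) zero_le_one fun i =>
        (Int.abs_sub_lt_one_of_floor_eq_floor (congrFun h i).symm).le
      simpa using this
    have h2 : U.1 (latticeVec z - latticeVec w) = U.1 (latticeVec z - s z) +
        (U.1 (s z) - U.1 (s w)) - U.1 (latticeVec w - s w) := by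
      simp only [map_sub]
      abel
    rw [h2]
    refine (norm_sub_le _ _).trans ?_
    have h3 := norm_add_le (U.1 (latticeVec z - s z)) (U.1 (s z) - U.1 (s w))
    have h4 := (norm_orthProj_apply_le U (latticeVec z - s z)).trans (hround z hz)
    have h5 := (norm_orthProj_apply_le U (latticeVec w - s w)).trans (hround w hw)
    linarith
  have hcount : (∑ z ∈ F, (F.filter fun w => φ w = φ z).card : ℝ) ≤ F.card * T := by
    have h1 : ((∑ z ∈ F, (F.filter fun w => φ w = φ z).card : ℕ) : ℝ≥0∞) ≤
        closePairs F (3 * d) U := by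
      unfold closePairs
      push_cast
      refine Finset.sum_le_sum fun z hz => ?_
      rw [Finset.card_filter]
      push_cast
      refine Finset.sum_le_sum fun w hw => ?_
      split_ifs with h
      · rw [Set.indicator_of_mem (by exact hpair z hz w hw h)]
        simp
      · exact zero_le
    have h2 := h1.trans hU
    rw [← ENNReal.ofReal_natCast] at h2
    have h3 := (ENNReal.ofReal_le_ofReal_iff (by positivity)).mp h2
    exact_mod_cast h3
  obtain ⟨z₀, hz₀⟩ := hne
  -- The cube is centred at `φ z₀`. Representatives differ by at most `2 * 2 ^ m` per coordinate, so
  -- their images by at most `2 * d * 2 ^ m`; the extra `2 * 2 ^ m` absorbs the floors.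
  refine ⟨fun i => φ z₀ i - (2 * d + 2) * 2 ^ m, ?_⟩
  have hsub : F.image φ ⊆ latticePoints (U.1 '' A)
      (fun i => φ z₀ i - (2 * d + 2) * 2 ^ m) ((4 * d + 4) * 2 ^ m) := by
    intro y hy
    obtain ⟨w, hw, rfl⟩ := Finset.mem_image.mp hy
    rw [mem_latticePoints]
    refine ⟨fun i => ?_, U.1 (s w), ⟨_, (hs w hw).1, rfl⟩, fun i => rfl⟩
    have hone : (1 : ℝ) ≤ 2 ^ m := one_le_pow₀ (by norm_num)
    have h1 : ‖s w - s z₀‖ ≤ d * (2 * 2 ^ m) := by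
      refine norm_le_of_forall_abs_le (by positivity) fun i => ?_
      change |s w i - s z₀ i| ≤ _
      have h2 : |(w i : ℝ) - z₀ i| < 2 ^ m := by exact_mod_cast hF w hw z₀ hz₀ i
      obtain ⟨h3, h4⟩ := hsz w hw i
      obtain ⟨h5, h6⟩ := hsz z₀ hz₀ i
      rw [abs_lt] at h2
      rw [abs_le]
      constructor <;> linarith
    have h2 : |U.1 (s w) i - U.1 (s z₀) i| ≤ d * (2 * 2 ^ m) := by
      have h3 := PiLp.norm_apply_le (U.1 (s w - s z₀)) i
      rw [map_sub] at h3
      refine h3.trans ?_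
      rw [← map_sub]
      exact (norm_orthProj_apply_le U _).trans h1
    have h3 := Int.floor_le (U.1 (s w) i)
    have h4 := Int.lt_floor_add_one (U.1 (s w) i)
    have h5 := Int.floor_le (U.1 (s z₀) i)
    have h6 := Int.lt_floor_add_one (U.1 (s z₀) i)
    rw [abs_le] at h2
    simp only [hφ]
    constructor <;> nlinarith
  have hcs : (F.card : ℝ) ^ 2 ≤
      (F.image φ).card * ∑ z ∈ F, ((F.filter fun w => φ w = φ z).card : ℝ) := by
    exact_mod_cast card_sq_le_card_image_mul F φ
  have hpos : (0 : ℝ) < F.card := by exact_mod_cast Finset.card_pos.mpr ⟨z₀, hz₀⟩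
  have h1 : (F.card : ℝ) ^ 2 ≤ (F.image φ).card * (F.card * T) :=
    hcs.trans (by gcongr)
  have h2 : (F.card : ℝ) ≤ (F.image φ).card * T := by
    refine le_of_mul_le_mul_left ?_ hpos
    calc _ = (F.card : ℝ) ^ 2 := by ring
      _ ≤ _ := h1
      _ = _ := by ring
  refine h2.trans ?_
  gcongr

/-- Positivity of a limsup needs only infinitely many good scales, so a uniform bound on the
normalised expectations and Fatou's lemma suffice. -/
theorem ae_cmeas_image_pos {d k : ℕ} (hk : k ≤ d) {A : Set (EuclideanSpace ℝ (Fin d))} {α : ℝ}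
    (hα : 0 ≤ α) (hαk : α ≠ k) (hA : 0 < cmeas α A) :
    ∀ᵐ U : orthProj d k ∂(orthProjMeasure hk), 0 < cmeas (min (k : ℝ) α) (U.1 '' A) := by
  obtain ⟨c, K, hc, hK, hreg⟩ := exists_regular hα hA
  choose m hm F hFA hFd hFc hFn using hreg
  set b : ℝ := (2 : ℝ) ^ α with hb
  have hb0 : 0 < b := by positivity
  have hbk : b ≠ 2 ^ k := by
    rw [hb, ← Real.rpow_natCast, ne_eq, Real.rpow_right_inj two_pos (by norm_num)]
    exact hαk
  have hR : (0 : ℝ) ≤ 3 * d := by positivity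
  obtain ⟨C, hC, hCi⟩ := exists_lintegral_closePairs_le hk hR hb0 hbk hK
  set σ : ℝ := max 1 (b / 2 ^ k) with hσ
  have hσ0 : 0 < σ := lt_max_of_lt_left one_pos
  have hF0 : ∀ n, (0 : ℝ) < (F n).card := fun n => lt_of_lt_of_le (by positivity) (hFc n)
  set T : ℕ → ℝ := fun n => (F n).card * σ ^ m n with hT
  have hT0 : ∀ n, 0 < T n := fun n => mul_pos (hF0 n) (by positivity)
  set f : ℕ → orthProj d k → ℝ≥0∞ := fun n U =>
    closePairs (F n) (3 * d) U / ENNReal.ofReal (T n) with hf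
  have hfm : ∀ n, Measurable (f n) := fun n => (measurable_closePairs _ _).div_const _
  have hfi : ∀ n, ∫⁻ U, f n U ∂(orthProjMeasure hk) ≤ ENNReal.ofReal C := by
    intro n
    simp only [hf, div_eq_mul_inv]
    rw [lintegral_mul_const _ (measurable_closePairs _ _), ← div_eq_mul_inv]
    refine ENNReal.div_le_of_le_mul ?_
    rw [← ENNReal.ofReal_mul hC]
    exact hCi _ _ (hFd n) (hFn n)
  have hlim : ∫⁻ U, liminf (fun n => f n U) atTop ∂(orthProjMeasure hk) < ∞ := by
    refine (lintegral_liminf_le hfm).trans_lt ?_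
    refine (liminf_le_of_le (by isBoundedDefault) (a := ENNReal.ofReal C) fun x hx => ?_).trans_lt
      ENNReal.ofReal_lt_top
    obtain ⟨n, hn⟩ := hx.exists
    exact hn.trans (hfi n)
  filter_upwards [ae_lt_top (Measurable.liminf hfm) hlim.ne] with U hU
  obtain ⟨M, hM1, hM2⟩ := exists_between hU
  have hfreq := frequently_lt_of_liminf_lt (by isBoundedDefault) hM1
  set M' : ℝ := M.toReal + 1 with hM'
  have hM'0 : 0 < M' := by positivity
  set γ : ℝ := min (k : ℝ) α with hγ
  have hγ0 : 0 ≤ γ := le_min (Nat.cast_nonneg _) hα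
  -- That is, `b / σ = min b (2 ^ k)`: the growth rate left after division by the number of
  -- collisions.
  have hquot : b / σ = 2 ^ γ := by
    have h2k : (2 : ℝ) ^ k = 2 ^ (k : ℝ) := (Real.rpow_natCast 2 k).symm
    rcases le_total α k with h | h
    · have h1 : b ≤ 2 ^ k := by
        rw [h2k]
        exact Real.rpow_le_rpow_of_exponent_le one_le_two h
      rw [hσ, max_eq_left ((div_le_one (by positivity)).mpr h1), hγ, min_eq_right h, div_one]
    · have h1 : 2 ^ k ≤ b := by
        rw [h2k]
        exact Real.rpow_le_rpow_of_exponent_le one_le_two h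
      rw [hσ, max_eq_right ((one_le_div (by positivity)).mpr h1), hγ, min_eq_left h, ← h2k]
      field_simp
  have hQ : (0 : ℝ) < 4 * d + 4 := by positivity
  have hQ1 : (1 : ℝ) ≤ 4 * d + 4 := by
    have : (0 : ℝ) ≤ d := Nat.cast_nonneg _
    linarith
  refine cmeas_pos_iff.mpr ⟨c / (M' * (4 * d + 4) ^ γ), by positivity, fun L => ?_⟩
  obtain ⟨N, hN⟩ := pow_unbounded_of_one_lt L (one_lt_two (α := ℝ))
  obtain ⟨n, hnM, hnN⟩ := (hfreq.and_eventually (eventually_ge_atTop N)).exists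
  have hclose : closePairs (F n) (3 * d) U ≤
      ENNReal.ofReal ((F n).card * (M' * σ ^ m n)) := by
    have h1 : closePairs (F n) (3 * d) U ≤ M * ENNReal.ofReal (T n) :=
      (ENNReal.div_le_iff (by simpa using hT0 n) ENNReal.ofReal_ne_top).mp hnM.le
    have h2 : M ≤ ENNReal.ofReal M' := by
      rw [← ENNReal.ofReal_toReal hM2.ne]
      exact ENNReal.ofReal_le_ofReal (by linarith)
    refine h1.trans ((mul_le_mul_left h2 _).trans (le_of_eq ?_))
    rw [← ENNReal.ofReal_mul hM'0.le]
    congr 1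
    simp only [hT]
    ring
  have hne : (F n).Nonempty := by
    rw [← Finset.card_pos]
    exact_mod_cast hF0 n
  obtain ⟨a, ha⟩ := exists_cube_of_closePairs_le U hne (hFA n) (hFd n) (by positivity) hclose
  refine ⟨a, (4 * d + 4) * 2 ^ m n, ?_, ?_⟩
  · have h1 : (2 : ℝ) ^ N ≤ 2 ^ m n := pow_le_pow_right₀ one_le_two (hnN.trans (hm n))
    have h2 : (0 : ℝ) < 2 ^ m n := by positivity
    nlinarith
  · have h1 : ((2 : ℝ) ^ m n) ^ γ = (2 ^ γ) ^ m n := by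
      rw [← Real.rpow_natCast, ← Real.rpow_natCast, ← Real.rpow_mul two_pos.le,
        ← Real.rpow_mul two_pos.le, mul_comm]
    rw [Real.mul_rpow hQ.le (by positivity), h1, ← hquot, div_pow]
    have h2 := (hFc n).trans ha
    have h3 : 0 < (4 * (d : ℝ) + 4) ^ γ := by positivity
    have h4 : 0 < σ ^ m n := by positivity
    calc c / (M' * (4 * d + 4) ^ γ) * ((4 * d + 4) ^ γ * (b ^ m n / σ ^ m n))
        = c * b ^ m n / (M' * σ ^ m n) := by field_simp
      _ ≤ _ := by
        rw [div_le_iff₀ (by positivity)]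
        exact h2

/-! ### The counting dimension -/

theorem cmeas_pos_of_le {d : ℕ} {A : Set (EuclideanSpace ℝ (Fin d))} {β γ : ℝ} (h : β ≤ γ)
    (hA : 0 < cmeas γ A) : 0 < cmeas β A := by
  rw [cmeas_pos_iff] at hA ⊢
  obtain ⟨c, hc, hcA⟩ := hA
  refine ⟨c, hc, fun L => ?_⟩
  obtain ⟨a, ℓ, h1, h2⟩ := hcA (max L 1)
  refine ⟨a, ℓ, (le_max_left _ _).trans h1, le_trans ?_ h2⟩
  have := Real.rpow_le_rpow_of_exponent_le ((le_max_right _ _).trans h1) h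
  gcongr

theorem card_latticePoints_le {d : ℕ} (A : Set (EuclideanSpace ℝ (Fin d))) (a : Fin d → ℝ)
    {ℓ : ℝ} (hℓ : 0 ≤ ℓ) : ((latticePoints A a ℓ).card : ℝ) ≤ (ℓ + 1) ^ d := by
  have h1 : ((latticePoints A a ℓ).card : ℝ) ≤ (cubePoints a ℓ).card :=
    Nat.cast_le.mpr (by classical exact Finset.card_filter_le _ _)
  refine h1.trans ?_
  rw [cubePoints, Fintype.card_piFinset, Nat.cast_prod]
  calc _ ≤ ∏ _i : Fin d, (ℓ + 1) := by
        refine Finset.prod_le_prod (fun i _ => Nat.cast_nonneg _) fun i _ => ?_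
        have h2 : ⌈a i⌉ ≤ ⌈a i + ℓ⌉ := Int.ceil_mono (by linarith)
        rw [Int.card_Ico, ← Int.cast_natCast, Int.toNat_of_nonneg (by omega), Int.cast_sub]
        linarith [Int.le_ceil (a i), Int.ceil_lt_add_one (a i + ℓ)]
    _ = (ℓ + 1) ^ d := by simp

/-- Shows that the infimum defining `cdim` is over a nonempty set. -/
theorem cmeas_add_one_eq_zero {d : ℕ} (A : Set (EuclideanSpace ℝ (Fin d))) :
    cmeas ((d : ℝ) + 1) A = 0 := by
  by_contra hne
  obtain ⟨c, hc, hcA⟩ := cmeas_pos_iff.mp (pos_iff_ne_zero.mpr hne)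
  obtain ⟨a, ℓ, h1, h2⟩ := hcA (max 1 (2 ^ d / c + 1))
  have hℓ1 : 1 ≤ ℓ := (le_max_left _ _).trans h1
  have hℓ2 : 2 ^ d / c < ℓ := by linarith [le_max_right 1 (2 ^ d / c + 1)]
  have hp : (0 : ℝ) < ℓ ^ d := by positivity
  rw [Real.rpow_add_one (by positivity), Real.rpow_natCast] at h2
  have h3 : (ℓ + 1) ^ d ≤ (2 * ℓ) ^ d := by gcongr; linarith
  have h4 := (h2.trans (card_latticePoints_le A a (by linarith))).trans h3
  rw [mul_pow] at h4
  rw [div_lt_iff₀ hc] at hℓ2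
  nlinarith

theorem cmeas_pos_of_lt_cdim {d : ℕ} {A : Set (EuclideanSpace ℝ (Fin d))} {α : ℝ} (hα : 0 ≤ α)
    (h : α < cdim A) : 0 < cmeas α A := by
  rw [pos_iff_ne_zero]
  intro h0
  have hle : cdim A ≤ α := csInf_le ⟨0, fun _ hx => hx.1⟩ ⟨hα, h0⟩
  exact absurd h (not_lt.mpr hle)

theorem le_cdim_of_cmeas_pos {d : ℕ} {A : Set (EuclideanSpace ℝ (Fin d))} {α : ℝ}
    (h : 0 < cmeas α A) : α ≤ cdim A := by
  refine le_csInf ⟨(d : ℝ) + 1, by positivity, cmeas_add_one_eq_zero A⟩ fun β hβ => ?_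
  by_contra! hlt
  exact (cmeas_pos_of_le hlt.le h).ne' hβ.2

theorem cdim_nonneg {d : ℕ} (A : Set (EuclideanSpace ℝ (Fin d))) : 0 ≤ cdim A :=
  Real.sInf_nonneg fun _ hx => hx.1

theorem ae_min_le_cdim_image {d k : ℕ} (hk : k ≤ d) (A : Set (EuclideanSpace ℝ (Fin d))) :
    ∀ᵐ U : orthProj d k ∂(orthProjMeasure hk),
      min (k : ℝ) (cdim A) ≤ cdim (U.1 '' A) ∧ ((k : ℝ) < cdim A → 0 < cmeas (k : ℝ) (U.1 '' A)) := by
  -- Restricting to rational exponents gives one null set for all of them. Exponents just below `min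
  -- k (cdim A)` yield the dimension bound; one strictly between `k` and `cdim A` yields the last
  -- claim.
  have hall : ∀ᵐ U : orthProj d k ∂(orthProjMeasure hk), ∀ q : ℚ, 0 ≤ (q : ℝ) → (q : ℝ) ≠ k →
      (q : ℝ) < cdim A → 0 < cmeas (min (k : ℝ) q) (U.1 '' A) := by
    rw [ae_all_iff]
    intro q
    by_cases hq : 0 ≤ (q : ℝ) ∧ (q : ℝ) ≠ k ∧ (q : ℝ) < cdim A
    · filter_upwards [ae_cmeas_image_pos hk hq.1 hq.2.1 (cmeas_pos_of_lt_cdim hq.1 hq.2.2)]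
        with U hU _ _ _ using hU
    · exact ae_of_all _ fun U h1 h2 h3 => absurd ⟨h1, h2, h3⟩ hq
  filter_upwards [hall] with U hU
  refine ⟨le_of_forall_lt fun t ht => ?_, fun hlt => ?_⟩
  · rcases lt_or_ge t 0 with ht0 | ht0
    · exact ht0.trans_le (cdim_nonneg _)
    · obtain ⟨q, hq1, hq2⟩ := exists_rat_btwn ht
      have hqk : (q : ℝ) < k := hq2.trans_le (min_le_left _ _)
      have h := hU q (ht0.trans hq1.le) hqk.ne (hq2.trans_le (min_le_right _ _))
      rw [min_eq_right hqk.le] at h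
      exact hq1.trans_le (le_cdim_of_cmeas_pos h)
  · obtain ⟨q, hq1, hq2⟩ := exists_rat_btwn hlt
    have h := hU q ((Nat.cast_nonneg k).trans hq1.le) hq1.ne' hq2
    rwa [min_eq_left hq1.le] at h

end CountingDim

end

theorem mainTheorem7 (d k : ℕ) (hk : k ≤ d) (A : Set (EuclideanSpace ℝ (Fin d))) :
    (∀ α : ℝ, 0 ≤ α → α ≠ (k : ℝ) → 0 < CountingDim.cmeas α A →
      ∀ᵐ U : CountingDim.orthProj d k ∂(CountingDim.orthProjMeasure hk),
        0 < CountingDim.cmeas (min (k : ℝ) α) (U.1 '' A)) ∧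
    (∀ᵐ U : CountingDim.orthProj d k ∂(CountingDim.orthProjMeasure hk),
      min (k : ℝ) (CountingDim.cdim A) ≤ CountingDim.cdim (U.1 '' A) ∧
      ((k : ℝ) < CountingDim.cdim A → 0 < CountingDim.cmeas (k : ℝ) (U.1 '' A))) :=
  ⟨fun _ hα hαk hA => CountingDim.ae_cmeas_image_pos hk hα hαk hA,
    CountingDim.ae_min_le_cdim_image hk A⟩
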